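/- All graphs are finite, simple and undirected. For a graph $S$, let $C_S(S,G)$ be the number of subgraphs of $G$ isomorphic to $S$. A class $\mathcal F$ of functions on graphs *can count* $S$ if for all graphs $G_1,G_2$ with $C_S(S,G_1)\neq C_S(S,G_2)$ there is $f\in\mathcal F$ with $f(G_1)\ne f(G_2)$. *Rooted subgraphs.* A tuple $\vec v=(v_1,\dots,v_k)\in V^k$ (entries may repeat) is *connected* if the subgraph induced on $\{v_1,\dots,v_k\}$ is connected. Its rooted $h$-hop subgraph $G_{\vec v}$ is the subgraph of $G$ induced on $V_{\vec v}=\{u : d_G(u,v_i)\le h \text{ for some } i\}$. Each node $u$ of $G_{\vec v}$ is labelled by its vector of distances to the roots, $\ell(u)=(d(u,v_1),\dots,d(u,v_k))$, with distances taken in $G_{\vec v}$. *$m$-WL.* On a node-labelled graph with node set $V$, the initial color of an $m$-tuple of nodes is its isomorphism type (the labels of its entries, their adjacency matrix, and which entries coincide). In each round the color of $\vec u$ is replaced by an injective hash of its previous color and, for $i=1,\dots,m$, the multiset of the previous colors of the tuples $(u_1,\dots,u_{i-1},w,u_{i+1},\dots,u_m)$, $w\in V$. Two labelled graphs are distinguished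 by $m$-WL if in some round their multisets of colors of all $m$-tuples differ. *Subgraph GNNs.* A subgraph GNN rooted at connected $k$-tuples has a hop parameter $h$ and computes, for every connected $k$-tuple $\vec v$ of $G$, colors of the $m$-tuples $\vec u\in V_{\vec v}^m$. The initial color $c^0_{\vec v,\vec u}$ is an injective hash of the isomorphism type of $\vec u$ in $(G_{\vec v},\ell)$, and $$c^t_{\vec v,\vec u}=\mathrm{HASH}\Big(\big(c^{t-1}_{\vec v,(v_{\sigma(1)},\dots,v_{\sigma(m)})}\big)_{\sigma:[m]\to[k]},\; c^{t-1}_{\vec v,\vec u},\; \big(\{\!\!\{c^{t-1}_{\vec v,(u_1,\dots,u_{i-1},w,u_{i+1},\dots,u_m)} : w\in V_{\vec v}\}\!\!\}\big)_{i\in[m]}\Big)$$ with $\mathrm{HASH}$ injective. After $T$ iterations, where $T$ may depend on $|V_{\vec v}|$, a readout function maps the multiset of the colors of all $\vec u\in V_{\vec v}^m$ to a representation $c_{\vec v}$, and the output for $G$ is a real-valued function of the multiset of all $c_{\vec v}$, $\vec v$ a connected $k$-tuple of $G$. Its *backbone is as powerful as $m$-WL* if for all graphs $G,G'$ and all connected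 $k$-tuples $\vec v$ of $G$ and $\vec v'$ of $G'$, $c_{\vec v}\ne c_{\vec v'}$ holds exactly when $m$-WL distinguishes the labelled graphs $G_{\vec v}$ and $G'_{\vec v'}$. **Theorem.** Let $m\ge 2$ and $k>0$, and let $S$ be a connected graph with at most $m+k$ nodes. Then there is a subgraph GNN rooted at connected $k$-tuples, with backbone as powerful as $m$-WL, whose output function $f$ counts $S$: for all graphs $G_1,G_2$ with $C_S(S,G_1)\neq C_S(S,G_2)$ one has $f(G_1)\neq f(G_2)$. -/

import Mathlib

namespace SubgraphCounting

/-- All finite simple undirected graphs, on the node sets `Fin N`. -/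
abbrev FinGraph : Type := Σ N : ℕ, SimpleGraph (Fin N)

/-- The number of subgraphs of `G` that are isomorphic to the substructure `S`. -/
noncomputable def subgraphCount (S G : FinGraph) : ℕ := G.2.copyCount S.2

/-- A class `F` of functions on graphs can count `S` if any two graphs containing different numbers
of copies of `S` are separated by some member of `F`. -/
def CanCount {α : Type*} (F : Set (FinGraph → α)) (S : FinGraph) : Prop :=
  ∀ G₁ G₂ : FinGraph, subgraphCount S G₁ ≠ subgraphCount S G₂ → ∃ f ∈ F, f G₁ ≠ f G₂

/-! ### The Weisfeiler-Leman algorithm on node-labelled graphs -/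

/-- The data determining the isomorphism type of an `m`-tuple of nodes carrying labels in `L`. -/
@[ext]
structure IsoType (m : ℕ) (L : Type) : Type where
  /-- the labels of the entries -/
  label : Fin m → L
  /-- the adjacency matrix of the induced subgraph, in the order of the tuple -/
  adj : Fin m → Fin m → Prop
  /-- which entries of the tuple coincide -/
  same : Fin m → Fin m → Prop

/-- The isomorphism type of the tuple `u` in the graph `G` with node labels `lab`. -/
def isoType {V L : Type} {m : ℕ} (G : SimpleGraph V) (lab : V → L) (u : Fin m → V) :
    IsoType m L where
  label i := lab (u i)
  adj i j := G.Adj (u i) (u j)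
  same i j := u i = u j

/-- The colors of the `t`-th round of `m`-WL, with the identity as the injective hash. -/
def WLColor (m : ℕ) (L : Type) : ℕ → Type
  | 0 => IsoType m L
  | t + 1 => WLColor m L t × (Fin m → Multiset (WLColor m L t))

/-- The color that `m`-WL gives to the tuple `u` in round `t`. The `i`-th neighbourhood of `u`
consists of the tuples obtained by replacing the `i`-th entry of `u` by each node. -/
def wlColor {V L : Type} [Fintype V] {m : ℕ} (G : SimpleGraph V) (lab : V → L) :
    (t : ℕ) → (Fin m → V) → WLColor m L t
  | 0, u => isoType G lab u
  | t + 1, u =>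
    (wlColor G lab t u,
      fun i => (Finset.univ : Finset V).val.map fun w =>
        wlColor G lab t (Function.update u i w))

/-- The color histogram of `m`-WL in round `t`: the multiset of the colors of all `m`-tuples. -/
def wlHistogram {V L : Type} [Fintype V] (m : ℕ) (G : SimpleGraph V)
    (lab : V → L) (t : ℕ) : Multiset (WLColor m L t) :=
  (Finset.univ : Finset (Fin m → V)).val.map (wlColor G lab t)

/-- `m`-WL distinguishes two node-labelled graphs if their color histograms differ in some round
(and then in all later rounds, the hash being injective). -/
def WLDistinguishes {V V' L : Type} [Fintype V] [Fintype V']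
    (m : ℕ) (G : SimpleGraph V) (lab : V → L) (G' : SimpleGraph V') (lab' : V' → L) : Prop :=
  ∃ t : ℕ, wlHistogram m G lab t ≠ wlHistogram m G' lab' t

/-! ### Rooted subgraphs -/

/-- A connected `k`-tuple: its entries, which may repeat, induce a connected subgraph. -/
def IsConnectedTuple {N k : ℕ} (G : SimpleGraph (Fin N)) (v : Fin k → Fin N) : Prop :=
  (G.induce (Set.range v)).Connected

/-- The union of the `h`-hop neighbourhoods of the entries of `v`. -/
def rootedNodes {N k : ℕ} (G : SimpleGraph (Fin N)) (h : ℕ) (v : Fin k → Fin N) :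
    Set (Fin N) :=
  {u | ∃ i, G.edist u (v i) ≤ h}

/-- The `h`-hop subgraph rooted at `v`, an induced subgraph of `G`. -/
abbrev rootedSubgraph {N k : ℕ} (G : SimpleGraph (Fin N)) (h : ℕ) (v : Fin k → Fin N) :
    SimpleGraph (rootedNodes G h v) :=
  G.induce (rootedNodes G h v)

noncomputable instance {N k : ℕ} (G : SimpleGraph (Fin N)) (h : ℕ) (v : Fin k → Fin N) :
    Fintype (rootedNodes G h v) :=
  Fintype.ofFinite _

/-- The `i`-th root, as a node of the rooted subgraph. -/
def root {N k : ℕ} (G : SimpleGraph (Fin N)) (h : ℕ) (v : Fin k → Fin N) (i : Fin k) :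
    rootedNodes G h v :=
  ⟨v i, i, by simp⟩

/-- The distance label of a node of the rooted subgraph: its shortest path distances, within the
rooted subgraph, to the `k` roots. -/
noncomputable def rootLabel {N k : ℕ} (G : SimpleGraph (Fin N)) (h : ℕ) (v : Fin k → Fin N)
    (u : rootedNodes G h v) : Fin k → ℕ∞ :=
  fun i => (rootedSubgraph G h v).edist u (root G h v i)

/-! ### Subgraph GNNs -/

/-- The parameters of a subgraph GNN rooted at connected `k`-tuples which colors the `m`-tuples of
nodes of each rooted subgraph. -/
structure SubgraphGNN (m k : ℕ) where
  /-- the hop parameter of the rooted subgraphs -/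
  hop : ℕ
  /-- the type of colors (node features) -/
  Color : Type
  /-- the initial color of an `m`-tuple, a hash of its isomorphism type -/
  init : IsoType m (Fin k → ℕ∞) → Color
  init_injective : Function.Injective init
  /-- the update function; its arguments are the colors of the root tuples, the previous color of
  the tuple itself and the multisets of colors of its `m` neighbourhoods -/
  hash : ((Fin m → Fin k) → Color) × Color × (Fin m → Multiset Color) → Color
  hash_injective : Function.Injective hash
  /-- the number of iterations, depending on the number of nodes of the rooted subgraph -/
  depth : ℕ → ℕ
  /-- the type of representations of rooted subgraphs -/
  Emb : Type
  /-- the readout function on the colors of all `m`-tuples of a rooted subgraph -/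
  readout : Multiset Color → Emb
  /-- the aggregation of the rooted subgraph representations into the output for the graph -/
  pool : Multiset Emb → ℝ

namespace SubgraphGNN

variable {m k N : ℕ} (Φ : SubgraphGNN m k)

/-- The color, after `t` iterations, of an `m`-tuple `u` in the subgraph rooted at `v`. Besides the
usual `m`-WL information the update sees the colors of the rooted tuple: since `v` has `k` entries
and colors belong to `m`-tuples, these are the colors of all tuples `v ∘ σ` with
`σ : Fin m → Fin k` (for `k = m` and `σ = id` this is the tuple `v` itself). -/
noncomputable def color (G : SimpleGraph (Fin N)) (v : Fin k → Fin N) :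
    ℕ → (Fin m → rootedNodes G Φ.hop v) → Φ.Color
  | 0, u => Φ.init (isoType (rootedSubgraph G Φ.hop v) (rootLabel G Φ.hop v) u)
  | t + 1, u =>
    Φ.hash
      (fun σ => color G v t (fun j => root G Φ.hop v (σ j)),
        color G v t u,
        fun i => (Finset.univ : Finset (rootedNodes G Φ.hop v)).val.map fun w =>
          color G v t (Function.update u i w))

/-- The representation of the subgraph rooted at `v`. -/
noncomputable def embed (G : SimpleGraph (Fin N)) (v : Fin k → Fin N) : Φ.Emb :=
  Φ.readout ((Finset.univ : Finset (Fin m → rootedNodes G Φ.hop v)).val.map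
    (Φ.color G v (Φ.depth (Fintype.card (rootedNodes G Φ.hop v)))))

open scoped Classical in
/-- The function on graphs computed by the subgraph GNN: the rooted subgraphs of all connected
`k`-tuples are encoded separately, and the representations are aggregated. -/
noncomputable def eval (G : FinGraph) : ℝ :=
  Φ.pool (((Finset.univ : Finset (Fin k → Fin G.1)).filter
    (fun v => IsConnectedTuple G.2 v)).val.map (Φ.embed G.2))

/-- The backbone is as powerful as `m`-WL: it separates two (distance-labelled) rooted subgraphs
exactly when `m`-WL distinguishes them. -/
def BackboneAsPowerfulAsWL : Prop :=
  ∀ (N N' : ℕ) (G : SimpleGraph (Fin N)) (G' : SimpleGraph (Fin N'))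
    (v : Fin k → Fin N) (v' : Fin k → Fin N'),
    IsConnectedTuple G v → IsConnectedTuple G' v' →
      (Φ.embed G v ≠ Φ.embed G' v' ↔
        WLDistinguishes m (rootedSubgraph G Φ.hop v) (rootLabel G Φ.hop v)
          (rootedSubgraph G' Φ.hop v') (rootLabel G' Φ.hop v'))

end SubgraphGNN

end SubgraphCounting

/-! ### Multisets and graph copies -/

/-! Counting copies of `S` amounts to counting labelled copies, since the two numbers differ by the
factor |Aut S|. Cover the nodes of `S` by a connected `k`-tuple `r` and an `m`-tuple `q`, and sort
the labelled copies φ by the connected tuple `v = φ ∘ r`. With hop parameter |S| such a copy lies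
inside the subgraph rooted at `v`, and it is determined by `u = φ ∘ q`. Whether `u` arises this way
depends only on its initial color and the labels of the roots: the isomorphism type covers pairs
inside `u`, and distance labels 0 and 1 reveal equality and adjacency with a root
(`isExtension_iff`). So the round-zero histogram gives the count at `v`, and summing over `v` gives
the total (`card_copy_eq_sum`).

A GNN with injective components outputs a code for the multiset of all embeddings. Its backbone is
exactly `m`-WL (`injectiveGNN_embed_eq_iff`) because refinement stabilizes within a number of rounds
bounded by size, and because the root-tuple colors add nothing: distance 0 identifies the roots. -/

theorem Multiset.map_eq_map_of_imp {α β γ δ : Type*} {s : Multiset α} {s' : Multiset β}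
    {f : α → γ} {f' : β → γ} {g : α → δ} {g' : β → δ} (h : s.map f = s'.map f')
    (hfg : ∀ a ∈ s, ∀ b ∈ s', f a = f' b → g a = g' b) : s.map g = s'.map g' := by
  rw [← Multiset.rel_eq, Multiset.rel_map] at h ⊢
  exact h.mono hfg

namespace SimpleGraph

/-- A labelled copy of `H` with image `B` is the same as an isomorphism from `H` to `B`. -/
noncomputable def isoEquivCopyFiber {V W : Type*} {G : SimpleGraph V} {H : SimpleGraph W}
    (B : G.Subgraph) : (H ≃g B.coe) ≃ {f : Copy H G // f.toSubgraph = B} :=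
  Equiv.ofBijective
    (fun e => ⟨⟨B.hom.comp e.toHom, Subgraph.hom_injective.comp e.injective⟩, by
      simp [Copy.toSubgraph, Subgraph.map_comp]⟩) <| by
    constructor
    · intro e e' h
      ext a
      exact congrArg (fun f : {f : Copy H G // f.toSubgraph = B} => f.1 a) h
    · rintro ⟨f, rfl⟩
      exact ⟨f.isoToSubgraph, rfl⟩

/-- Labelled copies fiber over their image subgraphs, and each fiber is a torsor under the
automorphisms of `H`. -/
theorem card_copy_eq_copyCount_mul {V W : Type*} [Fintype V] [Fintype W]
    (G : SimpleGraph V) (H : SimpleGraph W) :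
    Nat.card (Copy H G) = G.copyCount H * Nat.card (H ≃g H) := by
  classical
  have e : Copy H G ≃ {B : G.Subgraph // Nonempty (H ≃g B.coe)} × (H ≃g H) :=
    calc Copy H G
      _ ≃ Σ B : {B : G.Subgraph // Nonempty (H ≃g B.coe)}, {f : Copy H G // f.toSubgraph = B} :=
        (Equiv.sigmaSubtypeFiberEquiv _ _ fun f => ⟨f.isoToSubgraph⟩).symm
      _ ≃ Σ _ : {B : G.Subgraph // Nonempty (H ≃g B.coe)}, (H ≃g H) :=
        Equiv.sigmaCongrRight fun B => (isoEquivCopyFiber B.1).symm.trans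
          ⟨fun e => e.trans B.2.some.symm, fun e => e.trans B.2.some,
            fun e => by ext; simp, fun e => by ext; simp⟩
      _ ≃ _ := Equiv.sigmaEquivProd _ _
  rw [Nat.card_congr e, Nat.card_prod, Nat.card_eq_fintype_card, Fintype.card_subtype]
  rfl

theorem Connected.induce_range_comp {V W ι : Type*} {G : SimpleGraph V} {H : SimpleGraph W}
    {r : ι → W} (h : (H.induce (Set.range r)).Connected) (f : H →g G) :
    (G.induce (Set.range (f ∘ r))).Connected := by
  refine h.map (H := G.induce (Set.range (f ∘ r)))
    ⟨fun x => ⟨f x.1, by obtain ⟨_, i, rfl⟩ := x; exact ⟨i, rfl⟩⟩, fun hab => f.map_adj hab⟩ ?_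
  rintro ⟨_, i, rfl⟩
  exact ⟨⟨r i, i, rfl⟩, rfl⟩

/-- A connected graph has connected induced subgraphs of every size. -/
theorem Connected.exists_connected_induce_card {V : Type*} [Fintype V] {G : SimpleGraph V}
    (hG : G.Connected) {j : ℕ} (hj : 0 < j) (hjV : j ≤ Fintype.card V) :
    ∃ A : Finset V, A.card = j ∧ (G.induce (A : Set V)).Connected := by
  classical
  induction j, hj using Nat.le_induction with
  | base =>
    obtain ⟨a⟩ := hG.nonempty
    refine ⟨{a}, by simp, ?_⟩
    rw [Finset.coe_singleton]
    exact { preconnected := Preconnected.of_subsingleton, nonempty := ⟨a, rfl⟩ }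
  | succ j hj ih =>
    obtain ⟨A, hA, hconn⟩ := ih (by omega)
    obtain ⟨⟨a, ha⟩⟩ := hconn.nonempty
    obtain ⟨c, hc⟩ : ∃ c, c ∉ A := by
      by_contra! h
      have := Finset.card_le_card (fun x _ => h x : Finset.univ ⊆ A)
      rw [Finset.card_univ] at this
      omega
    -- A walk from inside `A` to outside crosses an edge leaving `A`; its far end is the node to
    -- add.
    obtain ⟨p⟩ := hG.preconnected a c
    obtain ⟨d, -, hd, hd'⟩ := p.exists_boundary_dart (A : Set V) ha hc
    refine ⟨insert d.snd A, by rw [Finset.card_insert_of_notMem (by simpa using hd'), hA], ?_⟩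
    have : ((insert d.snd A : Finset V) : Set V) = (A : Set V) ∪ {d.fst, d.snd} := by
      ext x
      simp only [Finset.coe_insert, Set.mem_insert_iff, Set.mem_union, Set.mem_singleton_iff]
      grind
    rw [this]
    exact induce_union_connected hconn.preconnected
      (induce_pair_connected_of_adj d.adj).preconnected ⟨d.fst, hd, by simp⟩

theorem Connected.edist_lt_card {V : Type*} [Fintype V] {G : SimpleGraph V}
    (hG : G.Connected) (a b : V) : G.edist a b < Fintype.card V := by
  classical
  obtain ⟨p⟩ := hG.preconnected a b
  exact lt_of_le_of_lt (edist_le p.toPath.1) (by exact_mod_cast p.toPath.2.length_lt)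

theorem edist_map_le {V W : Type*} {G : SimpleGraph V} {H : SimpleGraph W} (f : H →g G)
    (a b : W) : G.edist (f a) (f b) ≤ H.edist a b := by
  rw [edist, edist]
  refine le_iInf fun p => ?_
  simpa using iInf_le (fun p : G.Walk (f a) (f b) => (p.length : ℕ∞)) (p.map f)

end SimpleGraph

theorem Finset.exists_range_eq {α : Type*} {A : Finset α} {n : ℕ} (hA : A.Nonempty)
    (hn : A.card ≤ n) : ∃ f : Fin n → α, Set.range f = A := by
  have : Nonempty A := hA.to_subtype
  obtain ⟨e⟩ : Nonempty (A ↪ Fin n) :=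
    Function.Embedding.nonempty_of_card_le (by simpa using hn)
  refine ⟨Subtype.val ∘ Function.invFun e, ?_⟩
  rw [Set.range_comp, (Function.invFun_surjective e.injective).range_eq]
  simp

/-- The nodes of a connected graph with at most `m + k` nodes are covered by a connected `k`-tuple
and an `m`-tuple. -/
theorem SimpleGraph.Connected.exists_tuples {n m k : ℕ} {S : SimpleGraph (Fin n)}
    (hS : S.Connected) (hk : 0 < k) (hm : 0 < m) (hn : n ≤ m + k) :
    ∃ (r : Fin k → Fin n) (q : Fin m → Fin n),
      (S.induce (Set.range r)).Connected ∧ Function.Surjective (Sum.elim r q) := by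
  have hn0 : 0 < n := by obtain ⟨a⟩ := hS.nonempty; exact a.pos
  -- If `n < k`, then `A` is everything and `r` repeats entries.
  obtain ⟨A, hA, hconn⟩ := hS.exists_connected_induce_card (j := min k n) (by omega) (by simp)
  obtain ⟨r, hr⟩ := Finset.exists_range_eq (A := A) (n := k)
    (Finset.card_pos.1 (by omega)) (by omega)
  have hq : ∃ q : Fin m → Fin n, ∀ x ∉ A, x ∈ Set.range q := by
    rcases Aᶜ.eq_empty_or_nonempty with h | h
    · exact ⟨fun _ => ⟨0, hn0⟩, fun x hx => by simp_all⟩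
    · obtain ⟨q, hq⟩ := Finset.exists_range_eq (n := m) h
        (by rw [Finset.card_compl, Fintype.card_fin]; omega)
      exact ⟨q, fun x hx => by rw [hq]; simpa using hx⟩
  obtain ⟨q, hq⟩ := hq
  refine ⟨r, q, hr ▸ hconn, fun x => ?_⟩
  by_cases hx : x ∈ A
  · obtain ⟨i, hi⟩ : x ∈ Set.range r := hr ▸ hx
    exact ⟨.inl i, hi⟩
  · obtain ⟨i, hi⟩ := hq x hx
    exact ⟨.inr i, hi⟩

/-! ### Stabilization of color refinement -/

/-- A color refinement on a finite set `X` stabilizes after a number of rounds bounded in terms of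
the size of `X`. -/
theorem colorRefinement_stable {X ι : Type*} [Fintype X] {C : ℕ → Type*} (col : ∀ t, X → C t)
    (nb : X → ι → Multiset X)
    (hcol : ∀ t x y, col (t + 1) x = col (t + 1) y ↔
      col t x = col t y ∧ ∀ i, (nb x i).map (col t) = (nb y i).map (col t))
    {T : ℕ} (hT : 2 ^ (Fintype.card X ^ 2) ≤ T) {s : ℕ} (hs : T ≤ s) {x y : X}
    (hxy : col T x = col T y) : col s x = col s y := by
  classical
  -- The relations `E t` decrease, and by pigeonhole on the `2 ^ |X|²` subsets of `X × X` two of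
  -- them coincide by round `T`; one step without change persists.
  let E : ℕ → Set (X × X) := fun t => {p | col t p.1 = col t p.2}
  have anti : Antitone E := antitone_nat_of_succ_le fun t p hp => ((hcol t _ _).1 hp).1
  have imp : ∀ {a b}, E a ≤ E b → E (a + 1) ≤ E (b + 1) := by
    rintro a b hab ⟨x, y⟩ hxy
    obtain ⟨h1, h2⟩ := (hcol _ _ _).1 hxy
    exact (hcol _ _ _).2 ⟨hab (a := (x, y)) h1, fun i =>
      Multiset.map_eq_map_of_imp (h2 i) fun c _ d _ hcd => hab (a := (c, d)) hcd⟩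
  obtain ⟨i, hi, hii⟩ : ∃ i ≤ T, E i ≤ E (i + 1) := by
    obtain ⟨a, b, hab, he⟩ := Fintype.exists_ne_map_eq_of_card_lt
      (fun a : Fin (2 ^ (Fintype.card X ^ 2) + 1) => E a) (by simp [Fintype.card_set, sq])
    wlog hlt : a < b generalizing a b
    · exact this b a hab.symm he.symm (lt_of_le_of_ne (not_lt.1 hlt) hab.symm)
    exact ⟨a, by omega, he.le.trans (anti (Nat.succ_le_of_lt hlt))⟩
  have stable : ∀ d, E (i + d) ≤ E (i + d + 1) := fun d => by
    induction d with
    | zero => exact hii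
    | succ d ih => exact imp ih
  have mono : ∀ j, T ≤ j → E T ≤ E j := fun j hj => by
    induction j, hj using Nat.le_induction with
    | base => exact le_rfl
    | succ j hj ih =>
      obtain ⟨d, rfl⟩ := Nat.exists_eq_add_of_le (hi.trans hj)
      exact ih.trans (stable d)
  exact mono s hs (a := (x, y)) hxy

namespace SubgraphCounting

section WL

variable {V V' L : Type} [Fintype V] [Fintype V'] {m : ℕ} {G : SimpleGraph V} {lab : V → L}
  {G' : SimpleGraph V'} {lab' : V' → L}

theorem wlColor_eq_of_le {s t : ℕ} (hst : s ≤ t) {u : Fin m → V} {u' : Fin m → V'}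
    (h : wlColor G lab t u = wlColor G' lab' t u') : wlColor G lab s u = wlColor G' lab' s u' := by
  induction t, hst using Nat.le_induction with
  | base => exact h
  | succ t _ ih => exact ih (congrArg Prod.fst h)

/-- Equal histograms in a late enough round are equal in all rounds. -/
theorem wlHistogram_eq_of_stable (hV : Fintype.card V = Fintype.card V') {T : ℕ}
    (hT : 2 ^ ((Fintype.card V ^ m + Fintype.card V ^ m) ^ 2) ≤ T)
    (h : wlHistogram m G lab T = wlHistogram m G' lab' T) (t : ℕ) :
    wlHistogram m G lab t = wlHistogram m G' lab' t := by
  classical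
  refine Multiset.map_eq_map_of_imp h fun u _ u' _ huu => ?_
  rcases le_total t T with ht | ht
  · exact wlColor_eq_of_le ht huu
  -- Both graphs are refined together, on the disjoint union of their sets of tuples.
  let col : ∀ t, (Fin m → V) ⊕ (Fin m → V') → WLColor m L t :=
    fun t => Sum.elim (wlColor G lab t) (wlColor G' lab' t)
  let nb : (Fin m → V) ⊕ (Fin m → V') → Fin m → Multiset ((Fin m → V) ⊕ (Fin m → V')) :=
    Sum.elim (fun u i => (Finset.univ : Finset V).val.map fun w => .inl (Function.update u i w))
      (fun u i => (Finset.univ : Finset V').val.map fun w => .inr (Function.update u i w))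
  have hsucc : ∀ t x, col (t + 1) x = (col t x, fun i => (nb x i).map (col t)) := by
    rintro t (u | u) <;> simp [col, nb, wlColor, Function.comp_def] <;> rfl
  refine colorRefinement_stable col nb (fun t x y => ?_) ?_ ht (x := .inl u) (y := .inr u') huu
  · rw [hsucc, hsucc]
    exact Prod.ext_iff.trans (and_congr_right fun _ => funext_iff)
  · simpa [← hV] using hT

end WL

/-! ### Rooted subgraphs up to Weisfeiler-Leman equivalence -/

section Rooted

variable {m k h N N' : ℕ} {G : SimpleGraph (Fin N)} {G' : SimpleGraph (Fin N')}
  {v : Fin k → Fin N} {v' : Fin k → Fin N'}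

/-- Equal histograms give equal colors of the root tuples, since these can be recognized by their
labels. -/
theorem wlColor_root_eq {t : ℕ}
    (hist : wlHistogram m (rootedSubgraph G h v) (rootLabel G h v) t =
      wlHistogram m (rootedSubgraph G' h v') (rootLabel G' h v') t) (σ : Fin m → Fin k) :
    wlColor (rootedSubgraph G h v) (rootLabel G h v) t (fun j => root G h v (σ j)) =
      wlColor (rootedSubgraph G' h v') (rootLabel G' h v') t (fun j => root G' h v' (σ j)) := by
  have hmem : wlColor (rootedSubgraph G h v) (rootLabel G h v) t (fun j => root G h v (σ j)) ∈
      wlHistogram m (rootedSubgraph G' h v') (rootLabel G' h v') t :=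
    hist ▸ Multiset.mem_map_of_mem _ (Finset.mem_univ _)
  obtain ⟨u', -, hu'⟩ := Multiset.mem_map.1 hmem
  rw [← hu']
  congr 1
  funext j
  -- Entry `j` has distance 0 to root `σ j`, so the matching tuple does too.
  have := congrArg (fun c : IsoType m (Fin k → ℕ∞) => c.label j (σ j))
    (wlColor_eq_of_le (Nat.zero_le t) hu')
  simpa [wlColor, isoType, rootLabel] using this

theorem rootLabel_root_eq (hm : 0 < m)
    (hist : wlHistogram m (rootedSubgraph G h v) (rootLabel G h v) 0 =
      wlHistogram m (rootedSubgraph G' h v') (rootLabel G' h v') 0) (i : Fin k) :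
    rootLabel G h v (root G h v i) = rootLabel G' h v' (root G' h v' i) :=
  congrArg (fun c : IsoType m (Fin k → ℕ∞) => c.label ⟨0, hm⟩)
    (wlColor_root_eq hist fun _ => i)

/-- The tuple `u`, together with the roots, is the image under a copy of `S` of the tuples `r`
and `q`. -/
def IsExtension {n : ℕ} (S : SimpleGraph (Fin n)) (r : Fin k → Fin n) (q : Fin m → Fin n)
    (G : SimpleGraph (Fin N)) (h : ℕ) (v : Fin k → Fin N) (u : Fin m → rootedNodes G h v) : Prop :=
  ∀ a b, (Sum.elim (root G h v) u a = Sum.elim (root G h v) u b ↔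
      Sum.elim r q a = Sum.elim r q b) ∧
    (S.Adj (Sum.elim r q a) (Sum.elim r q b) →
      (rootedSubgraph G h v).Adj (Sum.elim (root G h v) u a) (Sum.elim (root G h v) u b))

theorem isExtension_iff {n : ℕ} (S : SimpleGraph (Fin n)) (r : Fin k → Fin n) (q : Fin m → Fin n)
    (hroot : ∀ i, rootLabel G h v (root G h v i) = rootLabel G' h v' (root G' h v' i))
    {u : Fin m → rootedNodes G h v} {u' : Fin m → rootedNodes G' h v'}
    (hu : isoType (rootedSubgraph G h v) (rootLabel G h v) u =
      isoType (rootedSubgraph G' h v') (rootLabel G' h v') u') :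
    IsExtension S r q G h v u ↔ IsExtension S r q G' h v' u' := by
  have hlab : ∀ a, rootLabel G h v (Sum.elim (root G h v) u a) =
      rootLabel G' h v' (Sum.elim (root G' h v') u' a) := by
    rintro (i | j)
    · exact hroot i
    · exact congrFun (congrArg IsoType.label hu) j
  have eq_root : ∀ a i, Sum.elim (root G h v) u a = root G h v i ↔
      Sum.elim (root G' h v') u' a = root G' h v' i := fun a i => by
    rw [← SimpleGraph.edist_eq_zero_iff (G := rootedSubgraph G h v),
      ← SimpleGraph.edist_eq_zero_iff (G := rootedSubgraph G' h v')]
    exact Eq.congr_left (congrFun (hlab a) i)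
  have adj_root : ∀ a i, (rootedSubgraph G h v).Adj (Sum.elim (root G h v) u a) (root G h v i) ↔
      (rootedSubgraph G' h v').Adj (Sum.elim (root G' h v') u' a) (root G' h v' i) := fun a i => by
    rw [← SimpleGraph.edist_eq_one_iff_adj, ← SimpleGraph.edist_eq_one_iff_adj]
    exact Eq.congr_left (congrFun (hlab a) i)
  refine forall_congr' fun a => forall_congr' fun b =>
    and_congr (iff_congr ?_ Iff.rfl) (imp_congr_right fun _ => ?_)
  · rcases b with i | j
    · exact eq_root a i
    rcases a with i | i
    · exact eq_comm.trans ((eq_root (.inr j) i).trans eq_comm)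
    · exact iff_of_eq (congrFun (congrFun (congrArg IsoType.same hu) i) j)
  · rcases b with i | j
    · exact adj_root a i
    rcases a with i | i
    · exact (SimpleGraph.adj_comm _ _ _).trans
        ((adj_root (.inr j) i).trans (SimpleGraph.adj_comm _ _ _))
    · exact iff_of_eq (congrFun (congrFun (congrArg IsoType.adj hu) i) j)

open scoped Classical in
theorem card_isExtension_eq (hm : 0 < m) {n : ℕ} (S : SimpleGraph (Fin n)) (r : Fin k → Fin n)
    (q : Fin m → Fin n)
    (hist : wlHistogram m (rootedSubgraph G h v) (rootLabel G h v) 0 =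
      wlHistogram m (rootedSubgraph G' h v') (rootLabel G' h v') 0) :
    (Finset.univ.filter (IsExtension S r q G h v)).card =
      (Finset.univ.filter (IsExtension S r q G' h v')).card := by
  rw [Finset.card_filter, Finset.card_filter]
  exact congrArg Multiset.sum (Multiset.map_eq_map_of_imp hist fun u _ u' _ huu =>
    if_congr (isExtension_iff S r q (rootLabel_root_eq hm hist) huu) rfl rfl)

open scoped Classical in
/-- The labelled copies of `S` mapping the tuple `r` to the roots `v` are counted in the subgraph
rooted at `v`. -/
theorem card_copy_fiber {n : ℕ} {S : SimpleGraph (Fin n)} (hS : S.Connected) {r : Fin k → Fin n}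
    {q : Fin m → Fin n} (hrq : Function.Surjective (Sum.elim r q)) (hk : 0 < k) (hn : n ≤ h)
    (G : SimpleGraph (Fin N)) (v : Fin k → Fin N) [Fintype (SimpleGraph.Copy S G)] :
    (Finset.univ.filter fun φ : SimpleGraph.Copy S G => φ ∘ r = v).card =
      (Finset.univ.filter (IsExtension S r q G h v)).card := by
  -- Distances in `S` are below `n ≤ h` and do not grow under φ.
  have hroots : ∀ φ : SimpleGraph.Copy S G, φ ∘ r = v → ∀ x, φ x ∈ rootedNodes G h v := by
    rintro φ rfl x
    refine ⟨⟨0, hk⟩, (SimpleGraph.edist_map_le φ.toHom _ _).trans ?_⟩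
    refine (hS.edist_lt_card _ _).le.trans ?_
    simpa using hn
  have helim : ∀ (φ : SimpleGraph.Copy S G) (hφ : φ ∘ r = v) a,
      (Sum.elim (root G h v) (fun j => ⟨φ (q j), hroots φ hφ _⟩) a : rootedNodes G h v).1 =
        φ (Sum.elim r q a) := by
    rintro φ hφ (i | j)
    · exact (congrFun hφ i).symm
    · rfl
  refine Finset.card_bij
    (fun φ hφ j => ⟨φ (q j), hroots φ (Finset.mem_filter.1 hφ).2 _⟩) ?_ ?_ ?_
  · intro φ hφ
    have hφ' := (Finset.mem_filter.1 hφ).2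
    refine Finset.mem_filter.2 ⟨Finset.mem_univ _, fun a b => ⟨?_, fun hab => ?_⟩⟩
    · rw [Subtype.ext_iff, helim φ hφ', helim φ hφ']
      exact φ.injective.eq_iff
    · rw [SimpleGraph.induce_adj, helim φ hφ', helim φ hφ']
      exact φ.toHom.map_adj hab
  · intro φ hφ ψ hψ hφψ
    have hφ' := (Finset.mem_filter.1 hφ).2
    have hψ' := (Finset.mem_filter.1 hψ).2
    ext x
    obtain ⟨a, rfl⟩ := hrq x
    rw [← helim φ hφ', ← helim ψ hψ', hφψ]
  · intro u hu
    have hu' := (Finset.mem_filter.1 hu).2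
    have hc := Function.surjInv_eq hrq
    -- The chosen preimage is immaterial: `u` with the roots repeats entries exactly as `r` with `q`
    -- does.
    have hval : ∀ a, Sum.elim (root G h v) u (Function.surjInv hrq (Sum.elim r q a)) =
        Sum.elim (root G h v) u a := fun a => (hu' _ _).1.2 (hc _)
    refine ⟨⟨⟨fun x => (Sum.elim (root G h v) u (Function.surjInv hrq x)).1, ?_⟩, ?_⟩, ?_, ?_⟩
    · intro x y hxy
      exact (hu' _ _).2 (by rwa [hc, hc])
    · intro x y hxy
      have := (hu' _ _).1.1 (Subtype.ext hxy)
      rwa [hc, hc] at this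
    · refine Finset.mem_filter.2 ⟨Finset.mem_univ _, funext fun i => ?_⟩
      exact congrArg Subtype.val (hval (.inl i))
    · exact funext fun j => Subtype.ext (congrArg Subtype.val (hval (.inr j)))

open scoped Classical in
theorem card_copy_eq_sum {n : ℕ} {S : SimpleGraph (Fin n)} (hS : S.Connected) {r : Fin k → Fin n}
    {q : Fin m → Fin n} (hr : (S.induce (Set.range r)).Connected)
    (hrq : Function.Surjective (Sum.elim r q)) (hk : 0 < k) (hn : n ≤ h)
    (G : SimpleGraph (Fin N)) :
    Nat.card (SimpleGraph.Copy S G) =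
      ∑ v ∈ Finset.univ.filter (fun v : Fin k → Fin N => IsConnectedTuple G v),
        (Finset.univ.filter (IsExtension S r q G h v)).card := by
  rw [Nat.card_eq_fintype_card, ← Finset.card_univ,
    Finset.card_eq_sum_card_fiberwise (f := fun φ : SimpleGraph.Copy S G => φ ∘ r)
      (t := Finset.univ.filter fun v : Fin k → Fin N => IsConnectedTuple G v)]
  · exact Finset.sum_congr rfl fun v _ => card_copy_fiber hS hrq hk hn G v
  · intro φ _
    exact Finset.mem_coe.2 (Finset.mem_filter.2
      ⟨Finset.mem_univ _, hr.induce_range_comp φ.toHom⟩)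

end Rooted

/-! ### A subgraph GNN with maximal expressive power -/

instance {m : ℕ} {L : Type} [Countable L] : Countable (IsoType m L) :=
  Function.Injective.countable (f := fun c : IsoType m L => (c.label, c.adj, c.same))
    fun c d h => by
      simp only [Prod.mk.injEq] at h
      exact IsoType.ext h.1 h.2.1 h.2.2

/-- An injective numbering of a countable type. -/
noncomputable def numbering (α : Type) [Countable α] : α → ℕ :=
  (exists_injective_nat α).choose

theorem numbering_injective (α : Type) [Countable α] : Function.Injective (numbering α) :=
  (exists_injective_nat α).choose_spec

/-- The subgraph GNN with hop parameter `h` all of whose components are injective. -/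
noncomputable def injectiveGNN (m k h : ℕ) : SubgraphGNN m k where
  hop := h
  Color := ℕ
  init := numbering _
  init_injective := numbering_injective _
  hash := numbering _
  hash_injective := numbering_injective _
  -- The stabilization bound for two graphs of `n` nodes, with `n ^ m` tuples each.
  depth n := 2 ^ ((n ^ m + n ^ m) ^ 2)
  Emb := Multiset ℕ
  readout := id
  pool s := numbering _ s

namespace SubgraphGNN

variable {m k N N' : ℕ} (Φ : SubgraphGNN m k) {G : SimpleGraph (Fin N)}
  {G' : SimpleGraph (Fin N')} {v : Fin k → Fin N} {v' : Fin k → Fin N'}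

theorem wlColor_eq_of_color_eq {t : ℕ} {u : Fin m → rootedNodes G Φ.hop v}
    {u' : Fin m → rootedNodes G' Φ.hop v'} (h : Φ.color G v t u = Φ.color G' v' t u') :
    wlColor (rootedSubgraph G Φ.hop v) (rootLabel G Φ.hop v) t u =
      wlColor (rootedSubgraph G' Φ.hop v') (rootLabel G' Φ.hop v') t u' := by
  induction t generalizing u u' with
  | zero => exact Φ.init_injective h
  | succ t ih =>
    have h' := Prod.ext_iff.1 (Prod.ext_iff.1 (Φ.hash_injective h)).2
    exact Prod.ext (ih h'.1) (funext fun i =>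
      Multiset.map_eq_map_of_imp (congrFun h'.2 i) fun _ _ _ _ hw => ih hw)

/-- The update also sees the root tuples, whose colors agree once the histograms do; hence the
hypothesis on all rounds. -/
theorem color_eq_of_wlColor_eq
    (hist : ¬ WLDistinguishes m (rootedSubgraph G Φ.hop v) (rootLabel G Φ.hop v)
      (rootedSubgraph G' Φ.hop v') (rootLabel G' Φ.hop v'))
    {t : ℕ} {u : Fin m → rootedNodes G Φ.hop v} {u' : Fin m → rootedNodes G' Φ.hop v'}
    (h : wlColor (rootedSubgraph G Φ.hop v) (rootLabel G Φ.hop v) t u =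
      wlColor (rootedSubgraph G' Φ.hop v') (rootLabel G' Φ.hop v') t u') :
    Φ.color G v t u = Φ.color G' v' t u' := by
  induction t generalizing u u' with
  | zero => exact congrArg Φ.init h
  | succ t ih =>
    have h' := Prod.ext_iff.1 h
    refine congrArg Φ.hash (Prod.ext (funext fun σ => ih ?_) (Prod.ext (ih h'.1) (funext fun i =>
      Multiset.map_eq_map_of_imp (congrFun h'.2 i) fun _ _ _ _ hw => ih hw)))
    exact wlColor_root_eq (not_not.1 (not_exists.1 hist t)) σ

end SubgraphGNN

variable {m k h : ℕ}

theorem card_injectiveGNN_embed {N : ℕ} (G : SimpleGraph (Fin N)) (v : Fin k → Fin N) :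
    Multiset.card ((injectiveGNN m k h).embed G v : Multiset ℕ) =
      Fintype.card (rootedNodes G h v) ^ m := by
  refine (Multiset.card_map _ _).trans ?_
  rw [Finset.card_val, Finset.card_univ, Fintype.card_fun, Fintype.card_fin]
  rfl

theorem injectiveGNN_embed_eq_iff (hm : 0 < m) {N N' : ℕ} {G : SimpleGraph (Fin N)}
    {G' : SimpleGraph (Fin N')} {v : Fin k → Fin N} {v' : Fin k → Fin N'} :
    (injectiveGNN m k h).embed G v = (injectiveGNN m k h).embed G' v' ↔
      ¬ WLDistinguishes m (rootedSubgraph G h v) (rootLabel G h v)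
          (rootedSubgraph G' h v') (rootLabel G' h v') := by
  constructor
  · intro he
    -- The number of tuples reveals the number of nodes, so both sides ran for equally many rounds.
    have hcard : Fintype.card (rootedNodes G h v) = Fintype.card (rootedNodes G' h v') := by
      have hc : Fintype.card (rootedNodes G h v) ^ m = Fintype.card (rootedNodes G' h v') ^ m := by
        rw [← card_injectiveGNN_embed, ← card_injectiveGNN_embed, he]
      exact Nat.pow_left_injective (Nat.pos_iff_ne_zero.1 hm) hc
    have he' := he
    simp only [SubgraphGNN.embed] at he'
    rw [show (Fintype.card (rootedNodes G' (injectiveGNN m k h).hop v')) =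
      Fintype.card (rootedNodes G (injectiveGNN m k h).hop v) from hcard.symm] at he'
    rintro ⟨t, ht⟩
    refine ht (wlHistogram_eq_of_stable hcard le_rfl ?_ t)
    exact Multiset.map_eq_map_of_imp he' fun u _ u' _ huu =>
      (injectiveGNN m k h).wlColor_eq_of_color_eq huu
  · intro hwl
    have hist := fun t => not_not.1 (not_exists.1 hwl t)
    have hcard : Fintype.card (rootedNodes G h v) = Fintype.card (rootedNodes G' h v') := by
      have hc : Fintype.card (rootedNodes G h v) ^ m = Fintype.card (rootedNodes G' h v') ^ m := by
        simpa [wlHistogram] using congrArg Multiset.card (hist 0)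
      exact Nat.pow_left_injective (Nat.pos_iff_ne_zero.1 hm) hc
    simp only [SubgraphGNN.embed]
    rw [show (Fintype.card (rootedNodes G' (injectiveGNN m k h).hop v')) =
      Fintype.card (rootedNodes G (injectiveGNN m k h).hop v) from hcard.symm]
    exact congrArg (injectiveGNN m k h).readout (Multiset.map_eq_map_of_imp (hist _)
      fun u _ u' _ huu => (injectiveGNN m k h).color_eq_of_wlColor_eq hwl huu)

theorem injectiveGNN_backbone (hm : 0 < m) :
    (injectiveGNN m k h).BackboneAsPowerfulAsWL := fun _ _ _ _ _ _ _ _ =>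
  (not_congr (injectiveGNN_embed_eq_iff hm)).trans not_not

theorem injectiveGNN_canCount (hm : 0 < m) (hk : 0 < k) (S : FinGraph) (hS : S.2.Connected)
    (hcard : S.1 ≤ m + k) (hh : S.1 ≤ h) : CanCount {(injectiveGNN m k h).eval} S := by
  classical
  intro G₁ G₂ hne
  refine ⟨_, rfl, fun heval => hne ?_⟩
  obtain ⟨r, q, hr, hrq⟩ := hS.exists_tuples hk hm hcard
  have hemb := numbering_injective _ (Nat.cast_injective (R := ℝ) heval)
  have hcopies : Nat.card (SimpleGraph.Copy S.2 G₁.2) = Nat.card (SimpleGraph.Copy S.2 G₂.2) := by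
    rw [card_copy_eq_sum hS hr hrq hk hh, card_copy_eq_sum hS hr hrq hk hh]
    refine congrArg Multiset.sum (Multiset.map_eq_map_of_imp hemb fun v _ v' _ hvv => ?_)
    have hwl := (injectiveGNN_embed_eq_iff hm).1 hvv
    exact card_isExtension_eq hm S.2 r q (not_not.1 (not_exists.1 hwl 0))
  rw [SimpleGraph.card_copy_eq_copyCount_mul, SimpleGraph.card_copy_eq_copyCount_mul] at hcopies
  -- The automorphism group is finite and nonempty, so its order cancels.
  have : Nonempty (S.2 ≃g S.2) := ⟨SimpleGraph.Iso.refl⟩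
  have : Finite (S.2 ≃g S.2) := DFunLike.finite _
  exact Nat.eq_of_mul_eq_mul_right Nat.card_pos hcopies

end SubgraphCounting

theorem theorem4p2 (m k : ℕ) (hm : 2 ≤ m) (hk : 0 < k)
    (S : SubgraphCounting.FinGraph) (hS : S.2.Connected) (hcard : S.1 ≤ m + k) :
    ∃ Φ : SubgraphCounting.SubgraphGNN m k,
      Φ.BackboneAsPowerfulAsWL ∧ SubgraphCounting.CanCount {Φ.eval} S :=
  ⟨SubgraphCounting.injectiveGNN m k S.1,
    SubgraphCounting.injectiveGNN_backbone (by omega),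
    SubgraphCounting.injectiveGNN_canCount (by omega) hk S hS hcard le_rfl⟩
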